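/- Let $\Omega$ be a finite set of questions and let $g:2^\Omega\to\mathbb R$ be non-decreasing and submodular with $g(\emptyset)=0$. Each $q\in\Omega$ has an answer-through-rate $p_q^+\in[0,1]$ and a continuation probability $c_q^+\in[0,1]$; each slot $i\ge 1$ has a decay factor $\lambda_i\in[0,1]$, where $\lambda_1=1$ and $\lambda_i\ge\lambda_j$ for $i\le j$. A sequence $Q$ of distinct questions is scanned from slot $1$ on: after reading $Q[i]$ the customer answers it and reads the next question with probability $\lambda_i p^+_{Q[i]}c^+_{Q[i]}$, answers it and exits with probability $\lambda_i p^+_{Q[i]}(1-c^+_{Q[i]})$, and exits without answering with probability $1-\lambda_i p^+_{Q[i]}$ (there is no "prefer not to answer" option); the process ends when the customer exits or no questions remain. Let $f(Q)=\sum_{\mathcal S\subseteq \mathcal Q}\Pr[\mathcal S\mid Q]\,g(\mathcal S)$, where $\mathcal Q$ is the set of questions in $Q$ and $\Pr[\mathcal S\mid Q]$ is the probability that $\mathcal S$ is exactly the set of answered questions. Let $b\ge 0$ be an integer and let $Q^*$ maximize $f$ over all sequences of at most $b$ distinct questions. Let $\rho\in[0,1]$, $\varepsilon>0$, $\Lambda_t=\prod_{1\le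 j\le t}\lambda_j$ and $$u(t,q,\mathcal S)=\lambda_t p_q^+\,g(\mathcal S\cup\{q\})+(1-\lambda_t p_q^+)\,g(\mathcal S).$$ For fixed $t\in\{1,\dots,b\}$ and $q\in\Omega$, problem $\mathbf{P2.1}$ is to maximize $u(t,q,\mathcal S)$ over all $\mathcal S\subseteq\Omega\setminus\{q\}$ with $|\mathcal S|<t$ and $-\bigl(\log\Lambda_t+\sum_{l\in\mathcal S}\log(p_l^+c_l^+)\bigr)\le-\log\rho$ (with $\log 0=-\infty$). Algorithm 3 starts with no incumbent (value $0$). For each $t=1,\dots,b$ and each $q\in\Omega$ (in any order of the questions) it applies a $(1-1/e-\varepsilon)$-approximate algorithm to $\mathbf{P2.1}$ with $t,q$ fixed, which returns a feasible $\mathcal S$ with $u(t,q,\mathcal S)\ge(1-1/e-\varepsilon)\,u(t,q,\mathcal T)$ for every feasible $\mathcal T$, or reports that no feasible set exists; if a set $\mathcal S$ is returned and $u(t,q,\mathcal S)$ exceeds the value of the incumbent, $(t,q,\mathcal S)$ becomes the incumbent. It outputs $Q^{\mathrm{Alg3}}=S'\oplus q'$, where $(t',q',\mathcal S')$ is the final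 incumbent and $S'$ is an arbitrary ordering of $\mathcal S'$ (the empty sequence if there is no incumbent). Then, for every such approximate algorithm and every choice of the orderings, $Q^{\mathrm{Alg3}}$ is a sequence of at most $b$ distinct questions and $$f(Q^{\mathrm{Alg3}})\ \ge\ \rho(1-\rho)\left(1-\frac1e-\varepsilon\right)f(Q^*).$$ In particular, if $\rho=1/2$, then $f(Q^{\mathrm{Alg3}})\ge\frac14\left(1-\frac1e-\varepsilon\right)f(Q^*)$. -/

import Mathlib

/-- A quiz design instance without the PNA option and with slot-dependent decay factors.
Slots are numbered `1, 2, 3, …`; the value `lam 0` is never used. -/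
structure QuizInstance (Ω : Type*) [DecidableEq Ω] where
  /-- answer-through-rate of a question -/
  p : Ω → ℝ
  /-- probability of continuing to the next question after answering -/
  c : Ω → ℝ
  /-- decay factor of a slot -/
  lam : ℕ → ℝ
  /-- utility of a set of answered questions -/
  g : Finset Ω → ℝ
  p_nonneg : ∀ q, 0 ≤ p q
  p_le_one : ∀ q, p q ≤ 1
  c_nonneg : ∀ q, 0 ≤ c q
  c_le_one : ∀ q, c q ≤ 1
  lam_one : lam 1 = 1
  lam_nonneg : ∀ i, 1 ≤ i → 0 ≤ lam i
  lam_anti : ∀ i j, 1 ≤ i → i ≤ j → lam j ≤ lam i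
  g_empty : g ∅ = 0
  g_mono : ∀ S T : Finset Ω, S ⊆ T → g S ≤ g T
  g_submodular : ∀ (S T : Finset Ω) (y : Ω), S ⊆ T → y ∉ T →
    g (insert y T) - g T ≤ g (insert y S) - g S

namespace QuizInstance

variable {Ω : Type*} [DecidableEq Ω] (M : QuizInstance Ω)

/-- The scanning process. `M.answerProb i Q A S` is the probability that the set of all questions
answered by the end of the quiz is `S`, given that the customer is about to read slot `i`, that the
questions from slot `i` on are `Q`, and that the set answered so far is `A`. On reading `q` in slot
`i` the customer exits without answering with probability `1 - lam i * p q`, answers and exits with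
probability `lam i * p q * (1 - c q)`, and answers and goes on to slot `i + 1` with probability
`lam i * p q * c q`. -/
noncomputable def answerProb : ℕ → List Ω → Finset Ω → Finset Ω → ℝ
  | _, [], A, S => if S = A then 1 else 0
  | i, q :: Q, A, S =>
      (1 - M.lam i * M.p q) * (if S = A then 1 else 0)
      + M.lam i * M.p q * (1 - M.c q) * (if S = insert q A then 1 else 0)
      + M.lam i * M.p q * M.c q * answerProb (i + 1) Q (insert q A) S

/-- Expected utility `f(Q) = ∑_{S ⊆ Q} Pr[S | Q] g(S)` of displaying the sequence `Q` in the
slots `1, …, |Q|`. -/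
noncomputable def f (Q : List Ω) : ℝ :=
  ∑ S ∈ Q.toFinset.powerset, M.answerProb 1 Q ∅ S * M.g S

/-- A feasible solution: a sequence of at most `b` distinct questions. -/
def IsFeasible (_M : QuizInstance Ω) (b : ℕ) (Q : List Ω) : Prop :=
  Q.Nodup ∧ Q.length ≤ b

/-- `Q` maximizes `f` among the feasible solutions. -/
def IsOptimal (b : ℕ) (Q : List Ω) : Prop :=
  M.IsFeasible b Q ∧ ∀ Q' : List Ω, M.IsFeasible b Q' → M.f Q' ≤ M.f Q

/-- `Λ_t = ∏_{1 ≤ j ≤ t} λ_j`. -/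
noncomputable def Lam (t : ℕ) : ℝ := ∏ j ∈ Finset.Icc 1 t, M.lam j

/-- Objective function `u(t, q, S)` of the selection problem. -/
noncomputable def u (t : ℕ) (q : Ω) (S : Finset Ω) : ℝ :=
  M.lam t * M.p q * M.g (insert q S) + (1 - M.lam t * M.p q) * M.g S

/-- Constraints on `S` in the selection problem for fixed last slot `t` and last question `q`.
Logarithms take values in the extended reals, with `log 0 = -∞`. -/
def SelFeasible [Fintype Ω] (ρ : ℝ) (t : ℕ) (q : Ω) (S : Finset Ω) : Prop :=
  -(ENNReal.log (ENNReal.ofReal (M.Lam t))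
      + ∑ l ∈ S, ENNReal.log (ENNReal.ofReal (M.p l * M.c l))) ≤ -ENNReal.log (ENNReal.ofReal ρ)
  ∧ S.card < t
  ∧ S ⊆ Finset.univ \ {q}

/-- The logarithmic constraint says `ρ ≤ Λ_t ∏_{l ∈ S} p_l c_l`. -/
theorem selFeasible_iff [Fintype Ω] (ρ : ℝ) (t : ℕ) (q : Ω) (S : Finset Ω) :
    M.SelFeasible ρ t q S ↔
      ρ ≤ M.Lam t * ∏ l ∈ S, (M.p l * M.c l) ∧ S.card < t ∧ q ∉ S := by
  have hLam : 0 ≤ M.Lam t :=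
    Finset.prod_nonneg fun j hj => M.lam_nonneg j (Finset.mem_Icc.mp hj).1
  have hpc : ∀ l, 0 ≤ M.p l * M.c l := fun l => mul_nonneg (M.p_nonneg l) (M.c_nonneg l)
  have hsum : ∀ T : Finset Ω, ∑ l ∈ T, ENNReal.log (ENNReal.ofReal (M.p l * M.c l))
      = ENNReal.log (ENNReal.ofReal (∏ l ∈ T, (M.p l * M.c l))) := by
    intro T
    induction T using Finset.induction_on with
    | empty => simp
    | insert a T ha ih =>
      rw [Finset.sum_insert ha, Finset.prod_insert ha, ih, ENNReal.ofReal_mul (hpc a),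
        ENNReal.log_mul_add]
  have hprod : 0 ≤ M.Lam t * ∏ l ∈ S, (M.p l * M.c l) :=
    mul_nonneg hLam (Finset.prod_nonneg fun l _ => hpc l)
  unfold SelFeasible
  rw [hsum, ← ENNReal.log_mul_add, ← ENNReal.ofReal_mul hLam, EReal.neg_le_neg_iff,
    ENNReal.log_le_log_iff, ENNReal.ofReal_le_ofReal_iff hprod]
  simp [Finset.subset_iff]

/-- `solver` is an `α`-approximate method for the selection problem: for all `1 ≤ t ≤ b` and all
`q` it returns a feasible set whose value is at least `α` times the value of every feasible set, or
reports (by `none`) that no feasible set exists. -/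
def IsApproxSolver [Fintype Ω] (ρ α : ℝ) (b : ℕ) (solver : ℕ → Ω → Option (Finset Ω)) : Prop :=
  ∀ t : ℕ, 1 ≤ t → t ≤ b → ∀ q : Ω,
    match solver t q with
    | none => ∀ S : Finset Ω, ¬ M.SelFeasible ρ t q S
    | some S => M.SelFeasible ρ t q S ∧
        ∀ T : Finset Ω, M.SelFeasible ρ t q T → α * M.u t q T ≤ M.u t q S

/-- Value of the incumbent candidate `(t', q', S')`; `none` is the initial state, in which no
question is selected, with value `g(∅) = 0`. -/
noncomputable def incumbentValue : Option (ℕ × Ω × Finset Ω) → ℝ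
  | none => 0
  | some (t, q, S) => M.u t q S

/-- Body of the double loop: replace the incumbent by the solver's candidate for `(t, q)` if the
latter has strictly larger value. -/
noncomputable def alg3Step (solver : ℕ → Ω → Option (Finset Ω))
    (st : Option (ℕ × Ω × Finset Ω)) (t : ℕ) (q : Ω) : Option (ℕ × Ω × Finset Ω) :=
  match solver t q with
  | none => st
  | some S => if M.incumbentValue st < M.u t q S then some (t, q, S) else st

/-- The double loop over `t = 1, …, b` and over the list `qs` of all questions. -/
noncomputable def alg3Loop (solver : ℕ → Ω → Option (Finset Ω)) (b : ℕ) (qs : List Ω) :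
    Option (ℕ × Ω × Finset Ω) :=
  (List.range' 1 b).foldl
    (fun st t => qs.foldl (fun st' q => M.alg3Step solver st' t q) st) none

/-- `Q` is a possible output of the algorithm: an arbitrary ordering of the final `S'` followed by
the final `q'` (the empty sequence if the incumbent was never updated). -/
def IsAlg3Output (solver : ℕ → Ω → Option (Finset Ω)) (b : ℕ) (qs : List Ω) (Q : List Ω) : Prop :=
  match M.alg3Loop solver b qs with
  | none => Q = []
  | some (_, q, S) => ∃ L : List Ω, L.Nodup ∧ L.toFinset = S ∧ Q = L ++ [q]

end QuizInstance

/-! The utility `f` obeys a recursion (`value`), in which a tail of a sequence contributes only if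
everything before it is answered and continued, an event of probability `reach` (`value_append`).
Upper bound: cut an optimal sequence where the probability `reach * lam` of noticing the next
question first drops below `ρ`. By submodularity and decay, the tail gains at most this probability
times its utility as a sequence of its own, hence at most `ρ * f Qstar` by optimality
(`exists_prefix_value_ge`). The kept prefix `L ++ [q]` is worth at most `u t q L.toFinset`, where
all of `L` is answered for sure, and its threshold condition is exactly the constraint of the
selection problem. Lower bound: for a feasible `S`, any ordering is completed with probability at
least `ρ`, so appending `q` yields at least `ρ * u t q S` (`f_ge_of_selFeasible`). The solver's
factor lies between the two bounds. -/

namespace QuizInstance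

/-! ### Recursive form of the expected utility -/

variable {Ω : Type*} [DecidableEq Ω] (M : QuizInstance Ω)

/-- Expected utility when the questions `Q` are shown from slot `i` on and the set answered so far
is `A`. -/
noncomputable def value : ℕ → List Ω → Finset Ω → ℝ
  | _, [], A => M.g A
  | i, q :: Q, A =>
      (1 - M.lam i * M.p q) * M.g A
      + M.lam i * M.p q * (1 - M.c q) * M.g (insert q A)
      + M.lam i * M.p q * M.c q * value (i + 1) Q (insert q A)

/-- Probability of answering all of `Q`, shown from slot `i` on, and going on after that. -/
noncomputable def reach : ℕ → List Ω → ℝ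
  | _, [] => 1
  | i, q :: Q => M.lam i * M.p q * M.c q * reach (i + 1) Q

/-- The fixed superset `U` lets the induction go through while `A` grows. -/
theorem sum_answerProb_mul_g (Q : List Ω) (i : ℕ) (A U : Finset Ω) (hA : A ⊆ U)
    (hQ : Q.toFinset ⊆ U) :
    ∑ S ∈ U.powerset, M.answerProb i Q A S * M.g S = M.value i Q A := by
  have hind : ∀ B : Finset Ω, B ⊆ U →
      ∑ S ∈ U.powerset, (if S = B then (1 : ℝ) else 0) * M.g S = M.g B := by
    intro B hB
    simp [Finset.sum_ite_eq', hB]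
  induction Q generalizing i A with
  | nil => simpa [answerProb, value] using hind A hA
  | cons q Q ih =>
    rw [List.toFinset_cons, Finset.insert_subset_iff] at hQ
    have hqA : insert q A ⊆ U := Finset.insert_subset hQ.1 hA
    rw [value, ← hind A hA, ← hind _ hqA, ← ih (i + 1) (insert q A) hqA hQ.2]
    simp only [Finset.mul_sum, ← Finset.sum_add_distrib, answerProb]
    exact Finset.sum_congr rfl fun S _ => by ring

theorem f_eq_value (Q : List Ω) : M.f Q = M.value 1 Q ∅ :=
  M.sum_answerProb_mul_g Q 1 ∅ _ (Finset.empty_subset _) subset_rfl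

theorem g_nonneg (A : Finset Ω) : 0 ≤ M.g A :=
  M.g_empty ▸ M.g_mono ∅ A (Finset.empty_subset A)

theorem g_le_insert (q : Ω) (A : Finset Ω) : M.g A ≤ M.g (insert q A) :=
  M.g_mono _ _ (Finset.subset_insert q A)

theorem lam_le_one {i : ℕ} (hi : 1 ≤ i) : M.lam i ≤ 1 :=
  M.lam_one ▸ M.lam_anti 1 i le_rfl hi

theorem lam_mul_p_nonneg {i : ℕ} (hi : 1 ≤ i) (q : Ω) : 0 ≤ M.lam i * M.p q :=
  mul_nonneg (M.lam_nonneg i hi) (M.p_nonneg q)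

theorem lam_mul_p_le_one {i : ℕ} (hi : 1 ≤ i) (q : Ω) : M.lam i * M.p q ≤ 1 :=
  mul_le_one₀ (M.lam_le_one hi) (M.p_nonneg q) (M.p_le_one q)

theorem Lam_nonneg (t : ℕ) : 0 ≤ M.Lam t :=
  Finset.prod_nonneg fun _ hj => M.lam_nonneg _ (Finset.mem_Icc.mp hj).1

theorem Lam_zero : M.Lam 0 = 1 := by simp [Lam]

theorem Lam_succ (t : ℕ) : M.Lam (t + 1) = M.Lam t * M.lam (t + 1) := by
  simp [Lam, Finset.prod_Icc_succ_top]

theorem Lam_anti {s t : ℕ} (h : s ≤ t) : M.Lam t ≤ M.Lam s := by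
  induction t, h using Nat.le_induction with
  | base => exact le_rfl
  | succ t _ ih =>
    rw [Lam_succ]
    exact (mul_le_of_le_one_right (M.Lam_nonneg t) (M.lam_le_one (by omega))).trans ih

theorem reach_nonneg (Q : List Ω) {i : ℕ} (hi : 1 ≤ i) : 0 ≤ M.reach i Q := by
  induction Q generalizing i with
  | nil => exact zero_le_one
  | cons q Q ih =>
    exact mul_nonneg (mul_nonneg (M.lam_mul_p_nonneg hi q) (M.c_nonneg q)) (ih (by omega))

/-- The factor `Lam i` completes the product of decay factors; multiplying by it avoids dividing by
a possible zero. -/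
theorem Lam_mul_reach (Q : List Ω) (i : ℕ) :
    M.Lam i * M.reach (i + 1) Q
      = M.Lam (i + Q.length) * (Q.map fun l => M.p l * M.c l).prod := by
  induction Q generalizing i with
  | nil => simp [reach]
  | cons q Q ih =>
    have h := ih (i + 1)
    rw [Lam_succ] at h
    simp only [reach, List.map_cons, List.prod_cons, List.length_cons]
    rw [show i + (Q.length + 1) = i + 1 + Q.length by ring]
    linear_combination M.p q * M.c q * h

theorem reach_one {Q : List Ω} (hQ : Q.Nodup) :
    M.reach 1 Q = M.Lam Q.length * ∏ l ∈ Q.toFinset, (M.p l * M.c l) := by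
  simpa [Lam_zero, List.prod_toFinset _ hQ] using M.Lam_mul_reach Q 0

/-! ### Diminishing gains -/

/-- Expected gain over `g A` from the questions shown from slot `i` on. -/
theorem value_cons_sub (i : ℕ) (q : Ω) (Q : List Ω) (A : Finset Ω) :
    M.value i (q :: Q) A - M.g A = M.lam i * (M.p q * ((M.g (insert q A) - M.g A)
      + M.c q * (M.value (i + 1) Q (insert q A) - M.g (insert q A)))) := by
  simp only [value]
  ring

theorem g_le_value (Q : List Ω) {i : ℕ} (hi : 1 ≤ i) (A : Finset Ω) :
    M.g A ≤ M.value i Q A := by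
  induction Q generalizing i A with
  | nil => exact le_rfl
  | cons q Q ih =>
    rw [← sub_nonneg, value_cons_sub]
    exact mul_nonneg (M.lam_nonneg i hi) (mul_nonneg (M.p_nonneg q) (add_nonneg
      (sub_nonneg.2 (M.g_le_insert q A))
      (mul_nonneg (M.c_nonneg q) (sub_nonneg.2 (ih (by omega) _)))))

theorem f_nonneg (Q : List Ω) : 0 ≤ M.f Q :=
  M.f_eq_value Q ▸ (M.g_nonneg ∅).trans (M.g_le_value Q le_rfl ∅)

/-- Submodularity freed of `q ∉ B`: otherwise the left side vanishes and monotonicity suffices. -/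
theorem g_insert_sub_le (q : Ω) {A B : Finset Ω} (h : A ⊆ B) :
    M.g (insert q B) - M.g B ≤ M.g (insert q A) - M.g A := by
  by_cases hq : q ∈ B
  · rw [Finset.insert_eq_of_mem hq, sub_self]
    exact sub_nonneg.2 (M.g_le_insert q A)
  · exact M.g_submodular A B q h hq

/-- Moving a sequence to earlier slots and shrinking the set answered before increases its gain. -/
theorem value_sub_g_le (Q : List Ω) {i j : ℕ} (hi : 1 ≤ i) (hij : i ≤ j) {A B : Finset Ω}
    (h : A ⊆ B) : M.value j Q B - M.g B ≤ M.value i Q A - M.g A := by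
  induction Q generalizing i j A B with
  | nil => simp [value]
  | cons q Q ih =>
    have hnn : 0 ≤ M.value (j + 1) Q (insert q B) - M.g (insert q B) :=
      sub_nonneg.2 (M.g_le_value Q (by omega) _)
    have := M.p_nonneg q
    have := M.c_nonneg q
    have := M.lam_nonneg i hi
    have h1 := sub_nonneg.2 (M.g_le_insert q B)
    rw [value_cons_sub, value_cons_sub]
    exact mul_le_mul (M.lam_anti i j hi hij) (mul_le_mul_of_nonneg_left (add_le_add
      (M.g_insert_sub_le q h) (mul_le_mul_of_nonneg_left
        (ih (by omega) (by omega) (Finset.insert_subset_insert q h)) (M.c_nonneg q)))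
      (M.p_nonneg q)) (by positivity) (M.lam_nonneg i hi)

/-- Any gain requires answering the first question, so `lam i` factors out, while in slot 1 this
factor is 1. This is why the cut threshold involves `lam` of the next slot. -/
theorem value_cons_sub_g_le (q : Ω) (Q : List Ω) {i : ℕ} (hi : 1 ≤ i) (B : Finset Ω) :
    M.value i (q :: Q) B - M.g B ≤ M.lam i * M.value 1 (q :: Q) ∅ := by
  have h := M.value_cons_sub 1 q Q ∅
  rw [M.g_empty, M.lam_one, sub_zero, one_mul] at h
  rw [value_cons_sub, h]
  refine mul_le_mul_of_nonneg_left (mul_le_mul_of_nonneg_left (add_le_add ?_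
    (mul_le_mul_of_nonneg_left ?_ (M.c_nonneg q))) (M.p_nonneg q)) (M.lam_nonneg i hi)
  · simpa [M.g_empty] using M.g_insert_sub_le q (Finset.empty_subset B)
  · exact M.value_sub_g_le Q (by omega) (by omega)
      (Finset.insert_subset_insert q (Finset.empty_subset B))

/-! ### Concatenation and comparison with `u` -/

theorem value_append (P Q : List Ω) (i : ℕ) (A : Finset Ω) :
    M.value i (P ++ Q) A = M.value i P A + M.reach i P *
      (M.value (i + P.length) Q (A ∪ P.toFinset) - M.g (A ∪ P.toFinset)) := by
  induction P generalizing i A with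
  | nil => simp [value, reach]
  | cons q P ih =>
    have h := ih (i + 1) (insert q A)
    rw [Finset.insert_union, ← Finset.union_insert, ← List.toFinset_cons,
      show i + 1 + P.length = i + (q :: P).length by simp; ring] at h
    simp only [List.cons_append, value, reach, h]
    ring

/-- Outcomes other than answering and continuing through all of `P` contribute nonnegatively. -/
theorem reach_mul_le_value (P : List Ω) {i : ℕ} (hi : 1 ≤ i) (A : Finset Ω) :
    M.reach i P * M.g (A ∪ P.toFinset) ≤ M.value i P A := by
  induction P generalizing i A with
  | nil => simp [value, reach]
  | cons q P ih =>
    have h := ih (i := i + 1) (by omega) (insert q A)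
    rw [Finset.insert_union, ← Finset.union_insert, ← List.toFinset_cons] at h
    have h1 := mul_nonneg (sub_nonneg.2 (M.lam_mul_p_le_one hi q)) (M.g_nonneg A)
    have h2 := mul_nonneg (mul_nonneg (M.lam_mul_p_nonneg hi q) (sub_nonneg.2 (M.c_le_one q)))
      (M.g_nonneg (insert q A))
    have h3 := mul_le_mul_of_nonneg_left h (mul_nonneg (M.lam_mul_p_nonneg hi q) (M.c_nonneg q))
    simp only [value, reach]
    linarith

theorem u_eq (t : ℕ) (q : Ω) (S : Finset Ω) :
    M.u t q S = M.g S + M.lam t * (M.p q * (M.g (insert q S) - M.g S)) := by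
  simp only [u]
  ring

theorem g_le_u {t : ℕ} (ht : 1 ≤ t) (q : Ω) (S : Finset Ω) : M.g S ≤ M.u t q S := by
  rw [u_eq]
  exact le_add_of_nonneg_right (mul_nonneg (M.lam_nonneg t ht)
    (mul_nonneg (M.p_nonneg q) (sub_nonneg.2 (M.g_le_insert q S))))

theorem u_nonneg {t : ℕ} (ht : 1 ≤ t) (q : Ω) (S : Finset Ω) : 0 ≤ M.u t q S :=
  (M.g_nonneg S).trans (M.g_le_u ht q S)

theorem u_anti {s t : ℕ} (hs : 1 ≤ s) (hst : s ≤ t) (q : Ω) (S : Finset Ω) :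
    M.u t q S ≤ M.u s q S := by
  rw [u_eq, u_eq]
  gcongr
  · exact mul_nonneg (M.p_nonneg q) (sub_nonneg.2 (M.g_le_insert q S))
  · exact M.lam_anti s t hs hst

theorem value_singleton (i : ℕ) (q : Ω) (A : Finset Ω) : M.value i [q] A = M.u i q A := by
  simp only [value, u]
  ring

theorem reach_mul_u_le_value (P : List Ω) (q : Ω) {i : ℕ} (hi : 1 ≤ i) (A : Finset Ω) :
    M.reach i P * M.u (i + P.length) q (A ∪ P.toFinset) ≤ M.value i (P ++ [q]) A := by
  rw [value_append, value_singleton]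
  linarith [M.reach_mul_le_value P hi A]

/-- An exit inside `P` leaves a subset of `A ∪ P.toFinset`, whose utility is at most `u`. -/
theorem value_concat_le_u (P : List Ω) (q : Ω) {i : ℕ} (hi : 1 ≤ i) (A : Finset Ω) :
    M.value i (P ++ [q]) A ≤ M.u (i + P.length) q (A ∪ P.toFinset) := by
  induction P generalizing i A with
  | nil => simp [value_singleton]
  | cons r P ih =>
    have h := ih (i := i + 1) (by omega) (insert r A)
    rw [Finset.insert_union, ← Finset.union_insert, ← List.toFinset_cons,
      show i + 1 + P.length = i + (r :: P).length by simp; ring] at h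
    set W := M.u (i + (r :: P).length) q (A ∪ (r :: P).toFinset)
    have hW : M.g (insert r A) ≤ W :=
      (M.g_mono _ _ (by rw [List.toFinset_cons, Finset.union_insert]
                        exact Finset.insert_subset_insert r Finset.subset_union_left)).trans
        (M.g_le_u (by omega) _ _)
    have h1 := mul_le_mul_of_nonneg_left ((M.g_le_insert r A).trans hW)
      (sub_nonneg.2 (M.lam_mul_p_le_one hi r))
    have h2 := mul_le_mul_of_nonneg_left hW
      (mul_nonneg (M.lam_mul_p_nonneg hi r) (sub_nonneg.2 (M.c_le_one r)))
    have h3 := mul_le_mul_of_nonneg_left h (mul_nonneg (M.lam_mul_p_nonneg hi r) (M.c_nonneg r))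
    simp only [List.cons_append, value]
    linarith

/-! ### Cutting an optimal sequence -/

/-- Cutting an optimal sequence after the last slot in which the question is noticed with
probability at least `ρ` costs at most the fraction `ρ` of its utility. -/
theorem exists_prefix_value_ge {b : ℕ} {ρ : ℝ} (hρ0 : 0 ≤ ρ) {Qstar : List Ω}
    (hQ : M.IsOptimal b Qstar) (B L : List Ω) (q : Ω) (hL : L ++ q :: B = Qstar)
    (hρ : ρ ≤ M.reach 1 L * M.lam (1 + L.length)) :
    ∃ L' q' B', L' ++ q' :: B' = Qstar ∧ ρ ≤ M.reach 1 L' * M.lam (1 + L'.length) ∧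
      (1 - ρ) * M.f Qstar ≤ M.value 1 (L' ++ [q']) ∅ := by
  induction B generalizing L q with
  | nil =>
    refine ⟨L, q, [], hL, hρ, ?_⟩
    rw [hL, ← f_eq_value]
    linarith [mul_nonneg hρ0 (M.f_nonneg Qstar)]
  | cons r B ih =>
    have hsplit : (L ++ [q]) ++ r :: B = Qstar := by simpa using hL
    by_cases hr : ρ ≤ M.reach 1 (L ++ [q]) * M.lam (1 + (L ++ [q]).length)
    · exact ih (L ++ [q]) r hsplit hr
    refine ⟨L, q, r :: B, hL, hρ, ?_⟩
    -- The tail competes with `Qstar` when shown alone from slot 1.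
    have hfeas : M.IsFeasible b (r :: B) := by
      obtain ⟨hnd, hlen⟩ := hQ.1
      rw [← hsplit] at hnd hlen
      rw [List.length_append] at hlen
      exact ⟨hnd.of_append_right, by omega⟩
    have hopt := hQ.2 _ hfeas
    have happ := M.value_append (L ++ [q]) (r :: B) 1 ∅
    rw [hsplit, ← f_eq_value] at happ
    have hgain := mul_le_mul_of_nonneg_left
      (M.value_cons_sub_g_le r B (i := 1 + (L ++ [q]).length) (by omega)
        (∅ ∪ (L ++ [q]).toFinset)) (M.reach_nonneg (L ++ [q]) le_rfl)
    rw [← f_eq_value, ← mul_assoc] at hgain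
    have htail := mul_le_mul (not_le.1 hr).le hopt (M.f_nonneg _) hρ0
    linarith

theorem incumbentValue_le_alg3Step (solver : ℕ → Ω → Option (Finset Ω))
    (st : Option (ℕ × Ω × Finset Ω)) (t : ℕ) (q : Ω) :
    M.incumbentValue st ≤ M.incumbentValue (M.alg3Step solver st t q) := by
  unfold alg3Step
  cases solver t q with
  | none => exact le_rfl
  | some S =>
    dsimp only
    split_ifs with hlt
    · exact hlt.le
    · exact le_rfl

/-! ### Feasible candidates and single steps of the algorithm -/

section Algorithm

variable [Fintype Ω]

theorem exists_selFeasible_u_ge {b : ℕ} {ρ : ℝ} (hρ0 : 0 ≤ ρ) (hρ1 : ρ ≤ 1) {Qstar : List Ω}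
    (hQ : M.IsOptimal b Qstar) (hne : Qstar ≠ []) :
    ∃ t q T, 1 ≤ t ∧ t ≤ b ∧ M.SelFeasible ρ t q T ∧ (1 - ρ) * M.f Qstar ≤ M.u t q T := by
  obtain ⟨q₀, B₀, rfl⟩ := List.exists_cons_of_ne_nil hne
  obtain ⟨L, q, B, hL, hρ, hval⟩ := M.exists_prefix_value_ge hρ0 hQ B₀ [] q₀ rfl
    (by simpa [reach, M.lam_one] using hρ1)
  obtain ⟨hnd, hlen⟩ := hQ.1
  rw [← hL] at hnd hlen
  have hLnd : L.Nodup := hnd.of_append_left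
  have hqL : q ∉ L := fun h => List.disjoint_of_nodup_append hnd h List.mem_cons_self
  rw [List.length_append, List.length_cons] at hlen
  refine ⟨1 + L.length, q, L.toFinset, by omega, by omega, ?_, ?_⟩
  · rw [selFeasible_iff, List.toFinset_card_of_nodup hLnd, List.mem_toFinset]
    refine ⟨hρ.trans_eq ?_, by omega, hqL⟩
    -- `reach 1 L` carries the decay of the slots before `q`; the extra `lam` completes `Lam t`.
    rw [reach_one M hLnd, Nat.add_comm 1, Lam_succ]
    ring
  · simpa using hval.trans (M.value_concat_le_u L q le_rfl ∅)

/-- `S` may have fewer than `t - 1` elements; moving `q` to an earlier slot only raises both `Lam`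
and `u`. -/
theorem f_ge_of_selFeasible {ρ : ℝ} {t : ℕ} {q : Ω} {S : Finset Ω}
    (h : M.SelFeasible ρ t q S) {L : List Ω} (hL : L.Nodup) (hLS : L.toFinset = S) :
    ρ * M.u t q S ≤ M.f (L ++ [q]) := by
  subst hLS
  rw [selFeasible_iff, List.toFinset_card_of_nodup hL] at h
  obtain ⟨hρ, hcard, -⟩ := h
  have hreach : ρ ≤ M.reach 1 L := by
    rw [reach_one M hL]
    exact hρ.trans (mul_le_mul_of_nonneg_right (M.Lam_anti hcard.le)
      (Finset.prod_nonneg fun l _ => mul_nonneg (M.p_nonneg l) (M.c_nonneg l)))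
  have hval := M.reach_mul_u_le_value L q le_rfl ∅
  rw [← f_eq_value, Finset.empty_union] at hval
  exact (mul_le_mul hreach (M.u_anti (by omega) (by omega) q _) (M.u_nonneg (by omega) q _)
    (M.reach_nonneg L le_rfl)).trans hval

/-- An incumbent is a feasible candidate of the selection problem for a slot in `1, …, b`. -/
def IncumbentFeasible (ρ : ℝ) (b : ℕ) (st : Option (ℕ × Ω × Finset Ω)) : Prop :=
  ∀ t q S, st = some (t, q, S) → 1 ≤ t ∧ t ≤ b ∧ M.SelFeasible ρ t q S

variable {M} {ρ α : ℝ} {b : ℕ} {solver : ℕ → Ω → Option (Finset Ω)}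

theorem IncumbentFeasible.alg3Step (hs : M.IsApproxSolver ρ α b solver)
    {st : Option (ℕ × Ω × Finset Ω)} (hst : M.IncumbentFeasible ρ b st) {t : ℕ} (ht1 : 1 ≤ t)
    (htb : t ≤ b) (q : Ω) : M.IncumbentFeasible ρ b (M.alg3Step solver st t q) := by
  have h := hs t ht1 htb q
  unfold QuizInstance.alg3Step
  cases hsol : solver t q with
  | none => exact hst
  | some S =>
    rw [hsol] at h
    dsimp only
    split_ifs
    · rintro _ _ _ ⟨⟩
      exact ⟨ht1, htb, h.1⟩
    · exact hst

theorem le_incumbentValue_alg3Step (hs : M.IsApproxSolver ρ α b solver)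
    (st : Option (ℕ × Ω × Finset Ω)) {t : ℕ} (ht1 : 1 ≤ t) (htb : t ≤ b) {q : Ω} {T : Finset Ω}
    (hT : M.SelFeasible ρ t q T) :
    α * M.u t q T ≤ M.incumbentValue (M.alg3Step solver st t q) := by
  have h := hs t ht1 htb q
  unfold alg3Step
  cases hsol : solver t q with
  | none =>
    rw [hsol] at h
    exact absurd hT (h T)
  | some S =>
    rw [hsol] at h
    refine (h.2 T hT).trans ?_
    dsimp only
    split_ifs with hlt
    · exact le_rfl
    · exact not_lt.1 hlt

end Algorithm

end QuizInstance

/-! ### Invariants of folds -/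

theorem List.foldl_invariant {α β : Type*} {P : α → Prop} {φ : α → β → α} (l : List β)
    (h : ∀ a, P a → ∀ x ∈ l, P (φ a x)) {a : α} (ha : P a) : P (l.foldl φ a) := by
  induction l generalizing a with
  | nil => exact ha
  | cons x l ih =>
    exact ih (fun a ha y hy => h a ha y (List.mem_cons_of_mem x hy)) (h a ha x List.mem_cons_self)

/-- A property that one step establishes and all steps preserve holds after the whole fold. -/
theorem List.foldl_of_mem {α β : Type*} {P : α → Prop} {φ : α → β → α} {l : List β} {x : β}
    (hx : x ∈ l) (h : ∀ a, P (φ a x)) (hP : ∀ a, P a → ∀ y ∈ l, P (φ a y)) (a : α) :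
    P (l.foldl φ a) := by
  obtain ⟨l₁, l₂, rfl⟩ := List.append_of_mem hx
  rw [List.foldl_append, List.foldl_cons]
  exact List.foldl_invariant l₂ (fun a ha y hy => hP a ha y (by simp [hy])) (h _)

/-! ### The full loop and its guarantee -/

namespace QuizInstance

variable {Ω : Type*} [Fintype Ω] [DecidableEq Ω] {M : QuizInstance Ω} {ρ α : ℝ} {b : ℕ}
  {solver : ℕ → Ω → Option (Finset Ω)}

theorem incumbentFeasible_alg3Loop (hs : M.IsApproxSolver ρ α b solver) (qs : List Ω) :
    M.IncumbentFeasible ρ b (M.alg3Loop solver b qs) := by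
  refine List.foldl_invariant _ (fun st hst t ht => List.foldl_invariant _
    (fun st' hst' q _ => ?_) hst) (fun _ _ _ h => by cases h)
  rw [List.mem_range'_1] at ht
  exact hst'.alg3Step hs ht.1 (by omega) q

theorem le_incumbentValue_alg3Loop (hs : M.IsApproxSolver ρ α b solver) {qs : List Ω} {t : ℕ}
    (ht1 : 1 ≤ t) (htb : t ≤ b) {q : Ω} (hq : q ∈ qs) {T : Finset Ω}
    (hT : M.SelFeasible ρ t q T) :
    α * M.u t q T ≤ M.incumbentValue (M.alg3Loop solver b qs) := by
  let P : Option (ℕ × Ω × Finset Ω) → Prop := fun st => α * M.u t q T ≤ M.incumbentValue st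
  refine List.foldl_of_mem (P := P) (x := t) (List.mem_range'_1.2 ⟨ht1, by omega⟩) (fun st => ?_)
    (fun st hst s _ => ?_) none
  · exact List.foldl_of_mem (P := P) hq (fun st' => le_incumbentValue_alg3Step hs st' ht1 htb hT)
      (fun st' hst' r _ => hst'.trans (M.incumbentValue_le_alg3Step solver st' t r)) st
  · exact List.foldl_invariant (P := P) _
      (fun st' hst' r _ => hst'.trans (M.incumbentValue_le_alg3Step solver st' s r)) hst

theorem IsAlg3Output.isFeasible_and_le_f (hs : M.IsApproxSolver ρ α b solver) {qs Q : List Ω}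
    (hQ : M.IsAlg3Output solver b qs Q) :
    M.IsFeasible b Q ∧ ρ * M.incumbentValue (M.alg3Loop solver b qs) ≤ M.f Q := by
  have hinc := incumbentFeasible_alg3Loop hs qs
  unfold IsAlg3Output at hQ
  generalize M.alg3Loop solver b qs = st at hQ hinc ⊢
  match st with
  | none =>
    subst hQ
    exact ⟨⟨List.nodup_nil, Nat.zero_le b⟩, by simpa [incumbentValue] using M.f_nonneg []⟩
  | some (t, q, S) =>
    obtain ⟨L, hL, hLS, rfl⟩ := hQ
    obtain ⟨-, htb, hfeas⟩ := hinc t q S rfl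
    refine ⟨⟨?_, ?_⟩, M.f_ge_of_selFeasible hfeas hL hLS⟩
    · rw [selFeasible_iff, ← hLS, List.mem_toFinset] at hfeas
      rw [← List.concat_eq_append, List.nodup_concat]
      exact ⟨hfeas.2.2, hL⟩
    · rw [selFeasible_iff, ← hLS, List.toFinset_card_of_nodup hL] at hfeas
      rw [List.length_append, List.length_singleton]
      omega

theorem IsAlg3Output.le_f (hρ0 : 0 ≤ ρ) (hρ1 : ρ ≤ 1) (hs : M.IsApproxSolver ρ α b solver)
    {qs Q Qstar : List Ω} (hqs : ∀ q, q ∈ qs) (hQ : M.IsAlg3Output solver b qs Q)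
    (hstar : M.IsOptimal b Qstar) : ρ * (1 - ρ) * α * M.f Qstar ≤ M.f Q := by
  have hf := (hQ.isFeasible_and_le_f hs).2
  have hnn := M.f_nonneg Q
  have hρρ : 0 ≤ ρ * (1 - ρ) := mul_nonneg hρ0 (sub_nonneg.2 hρ1)
  -- A large `ε` makes `α` negative; then the bound is trivial, as `f` is nonnegative.
  rcases lt_or_ge α 0 with hα | hα
  · exact (mul_nonpos_of_nonpos_of_nonneg (mul_nonpos_of_nonneg_of_nonpos hρρ hα.le)
      (M.f_nonneg Qstar)).trans hnn
  by_cases hne : Qstar = []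
  · have : M.f Qstar = 0 := by rw [hne, f_eq_value, value, M.g_empty]
    rw [this, mul_zero]
    exact hnn
  obtain ⟨t, q, T, ht1, htb, hT, hu⟩ := M.exists_selFeasible_u_ge hρ0 hρ1 hstar hne
  calc ρ * (1 - ρ) * α * M.f Qstar = ρ * (α * ((1 - ρ) * M.f Qstar)) := by ring
    _ ≤ ρ * (α * M.u t q T) := by gcongr
    _ ≤ ρ * M.incumbentValue (M.alg3Loop solver b qs) :=
      mul_le_mul_of_nonneg_left (le_incumbentValue_alg3Loop hs ht1 htb (hqs q) hT) hρ0
    _ ≤ M.f Q := hf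

end QuizInstance

theorem mainTheorem5 {Ω : Type*} [Fintype Ω] [DecidableEq Ω] (M : QuizInstance Ω)
    (b : ℕ) (ρ ε : ℝ) (hρ0 : 0 ≤ ρ) (hρ1 : ρ ≤ 1) (hε : 0 < ε)
    (solver : ℕ → Ω → Option (Finset Ω))
    (hsolver : M.IsApproxSolver ρ (1 - 1 / Real.exp 1 - ε) b solver)
    (qs : List Ω) (hqs_nodup : qs.Nodup) (hqs_all : ∀ q : Ω, q ∈ qs)
    (Qalg : List Ω) (hQalg : M.IsAlg3Output solver b qs Qalg)
    (Qstar : List Ω) (hQstar : M.IsOptimal b Qstar) :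
    M.IsFeasible b Qalg ∧
    M.f Qalg ≥ ρ * (1 - ρ) * (1 - 1 / Real.exp 1 - ε) * M.f Qstar ∧
    (ρ = 1 / 2 → M.f Qalg ≥ (1 - 1 / Real.exp 1 - ε) / 4 * M.f Qstar) := by
  have h := hQalg.le_f hρ0 hρ1 hsolver hqs_all hQstar
  refine ⟨(hQalg.isFeasible_and_le_f hsolver).1, h, ?_⟩
  rintro rfl
  refine h.trans_eq' ?_
  ring
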